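/- Let $G_1,G_2,\dots$ be undirected graphs (multiple edges and loops are allowed, and no girth condition is imposed), each with a finite number $n_m$ of edges, such that $n_m\to\infty$. Edges are abstract objects, and any edge in $E(G_m)\cap E(G_n)$ has the same endpoints in $G_m$ and $G_n$. Put $\mathcal V=\bigcup_m V(G_m)$ and $\mathcal E=\bigcup_m E(G_m)$, and let $\ell\ge 2$ be an integer. Let $M_i$, $i\in\mathcal V$, be mutually independent random variables, uniform on $\{1,\dots,\ell\}$. For an edge $k\in\mathcal E$ with endpoints $i,j$, let $D_k=1$ if $M_i=M_j$ and $D_k=0$ otherwise, and let $$\xi^*_m=\frac{\sum_{k\in E(G_m)}D_k-n_m\ell^{-1}}{\sqrt{n_m\ell^{-1}(1-\ell^{-1})}}.$$ Let $U,V$ be real random variables with finite variances, and let $W$ be a real random variable such that $$\Pr(W\in C)=(1-\ell^{-1})\Pr(U\in C)+\ell^{-1}\Pr(V\in C)\quad\text{for all Borel } C\subseteq\mathbb R.$$ Let $\mu=\mathbb E W$ and $\sigma^2=\operatorname{Var}(W)$, and assume $0<\sigma<\infty$. Let $U_k,V_k$, $k\in\mathcal E$, be mutually independent random variables, with $U_k$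 distributed as $U$ and $V_k$ distributed as $V$, such that the family $(U_k,V_k)_{k\in\mathcal E}$ is independent of the family $(M_i)_{i\in\mathcal V}$. Let $X_k=U_k$ if $D_k=0$ and $X_k=V_k$ if $D_k=1$. Finally let $$r=\sqrt{\ell^{-1}(1-\ell^{-1})}\,\frac{\mathbb E V-\mathbb E U}{\sigma}.$$ Then $r^2\le 1$, and if $\xi^*_m$ converges in law to a random variable $Y$ as $m\to\infty$, then $$S^*_m=\frac{\sum_{k\in E(G_m)}X_k-n_m\mu}{\sigma\sqrt{n_m}}$$ converges in law, as $m\to\infty$, to $\sqrt{1-r^2}\,Z+rY$, where $Z$ is a standard normal random variable independent of $Y$. -/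

import Mathlib

open MeasureTheory ProbabilityTheory Filter Topology

noncomputable section

namespace MonoEdges

/-- The vertices occurring in at least one graph of the sequence. -/
def allVerts {α β : Type*} (G : ℕ → Graph α β) : Set α := ⋃ m, (G m).vertexSet

/-- The edges occurring in at least one graph of the sequence. -/
def allEdges {α β : Type*} (G : ℕ → Graph α β) : Set β := ⋃ m, (G m).edgeSet

open scoped Classical in
/-- `D_k`: equal to `1` if the endpoints of the edge `k` have the same colour, and `0` otherwise.
When the graphs are pairwise compatible, the endpoints of `k` do not depend on the graph `G m`
that contains it. -/
def D {α β Ω C : Type*} (G : ℕ → Graph α β) (M : α → Ω → C) (k : β) (ω : Ω) : ℕ :=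
  if ∃ m i j, (G m).IsLink k i j ∧ M i ω = M j ω then 1 else 0

/-- `X_k`: equal to `U_k` if `D_k = 0` and to `V_k` if `D_k = 1`. -/
def X {α β Ω C : Type*} (G : ℕ → Graph α β) (M : α → Ω → C) (Uk Vk : β → Ω → ℝ)
    (k : β) (ω : Ω) : ℝ :=
  if D G M k ω = 0 then Uk k ω else Vk k ω

/-- The standardized number of monochromatic edges in the finite edge set `E`, where
`ℓ` is the number of colours. -/
def xi {α β Ω C : Type*} (ℓ : ℕ) (G : ℕ → Graph α β) (M : α → Ω → C) (E : Finset β)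
    (ω : Ω) : ℝ :=
  ((∑ k ∈ E, (D G M k ω : ℝ)) - E.card * (ℓ : ℝ)⁻¹) /
    √(E.card * (ℓ : ℝ)⁻¹ * (1 - (ℓ : ℝ)⁻¹))

/-- The sum of the `X_k` over the finite edge set `E`, standardized with mean `μ` and standard
deviation `σ` per summand. -/
def S {α β Ω C : Type*} (G : ℕ → Graph α β) (M : α → Ω → C) (Uk Vk : β → Ω → ℝ)
    (μ σ : ℝ) (E : Finset β) (ω : Ω) : ℝ :=
  ((∑ k ∈ E, X G M Uk Vk k ω) - E.card * μ) / (σ * √E.card)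

end MonoEdges

end

namespace MonoEdges

/-! Write `p = ℓ⁻¹`, `n` for the number of edges and `s = t / (σ√n)`. Given the colours, the `X_k`
are independent, so with `B` monochromatic edges the sum has conditional characteristic function
`φ_U(s) ^ (n - B) * φ_V(s) ^ B` (`charFun_sum_X`). Replacing `U` and `V` by Gaussians with the same
mean and variance costs `n * o(s ^ 2) = o(1)`, uniformly in the colours.

For Gaussians the centred expression is exactly `phase` at `(ξ*, 1/√n)` (`phase_eq_gaussian_pow`):
the conditional mean contributes `t r ξ*`, and the conditional variance depends on `B / n = p +
√(p(1-p)) ξ* / √n`. As `phase` is bounded and continuous, Slutsky's theorem gives the limit `E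
phase(Y, 0)`, in which the variance weight is frozen at `p`.

The mixture identity `σ² = (1-p) Var U + p Var V + σ² r²` shows that `r² ≤ 1` and that the remaining
Gaussian variance is `1 - r²`. -/

/-! ### Comparison of powers in the unit disc -/

lemma norm_pow_sub_pow_le {z w : ℂ} (hz : ‖z‖ ≤ 1) (hw : ‖w‖ ≤ 1) (n : ℕ) :
    ‖z ^ n - w ^ n‖ ≤ n * ‖z - w‖ := by
  induction n with
  | zero => simp
  | succ n ih =>
    have h : z ^ (n + 1) - w ^ (n + 1) = z ^ n * (z - w) + (z ^ n - w ^ n) * w := by ring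
    rw [h]
    refine (norm_add_le _ _).trans ?_
    rw [norm_mul, norm_mul, norm_pow]
    have h1 : ‖z‖ ^ n * ‖z - w‖ ≤ 1 * ‖z - w‖ :=
      mul_le_mul_of_nonneg_right (pow_le_one₀ (norm_nonneg _) hz) (norm_nonneg _)
    have h2 : ‖z ^ n - w ^ n‖ * ‖w‖ ≤ ‖z ^ n - w ^ n‖ * 1 :=
      mul_le_mul_of_nonneg_left hw (norm_nonneg _)
    push_cast
    linarith

/-- Changing one factor at a time costs at most one difference per factor. The bound sees only `a +
b`, hence is uniform in the colouring. -/
lemma norm_pow_mul_pow_sub_le {z w z' w' : ℂ} (hz : ‖z‖ ≤ 1) (hw : ‖w‖ ≤ 1)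
    (hz' : ‖z'‖ ≤ 1) (hw' : ‖w'‖ ≤ 1) {a b n : ℕ} (hab : a + b = n) :
    ‖z ^ a * z' ^ b - w ^ a * w' ^ b‖ ≤ n * (‖z - w‖ + ‖z' - w'‖) := by
  have h : z ^ a * z' ^ b - w ^ a * w' ^ b =
      (z ^ a - w ^ a) * z' ^ b + w ^ a * (z' ^ b - w' ^ b) := by ring
  rw [h]
  refine (norm_add_le _ _).trans ?_
  rw [norm_mul, norm_mul, norm_pow z', norm_pow w]
  have h1 : ‖z ^ a - w ^ a‖ * ‖z'‖ ^ b ≤ ‖z ^ a - w ^ a‖ * 1 :=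
    mul_le_mul_of_nonneg_left (pow_le_one₀ (norm_nonneg _) hz') (norm_nonneg _)
  have h2 : ‖w‖ ^ a * ‖z' ^ b - w' ^ b‖ ≤ 1 * ‖z' ^ b - w' ^ b‖ :=
    mul_le_mul_of_nonneg_right (pow_le_one₀ (norm_nonneg _) hw) (norm_nonneg _)
  have h3 := norm_pow_sub_pow_le hz hw a
  have h4 := norm_pow_sub_pow_le hz' hw' b
  have h5 : (a : ℝ) * ‖z - w‖ ≤ n * ‖z - w‖ :=
    mul_le_mul_of_nonneg_right (by exact_mod_cast (by omega : a ≤ n)) (norm_nonneg _)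
  have h6 : (b : ℝ) * ‖z' - w'‖ ≤ n * ‖z' - w'‖ :=
    mul_le_mul_of_nonneg_right (by exact_mod_cast (by omega : b ≤ n)) (norm_nonneg _)
  linarith

/-! ### Second-order comparison with Gaussians -/

/-- Probability measures with the same first two moments have characteristic functions that agree
up to `o(s ^ 2)` at the origin. -/
lemma charFun_sub_charFun_isLittleO {ν ρ : Measure ℝ} [IsProbabilityMeasure ν]
    [IsProbabilityMeasure ρ] (hν : MemLp id 2 ν) (hρ : MemLp id 2 ρ)
    (h1 : ∫ x, x ∂ν = ∫ x, x ∂ρ) (h2 : ∫ x, x ^ 2 ∂ν = ∫ x, x ^ 2 ∂ρ) :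
    (fun s => charFun ν s - charFun ρ s) =o[𝓝 0] fun s : ℝ => s ^ 2 := by
  have key : ∀ {τ : Measure ℝ} [IsProbabilityMeasure τ], MemLp id 2 τ →
      (fun s => charFun τ s - (1 + (∫ x, x ∂τ : ℝ) * s * Complex.I
        - (∫ x, x ^ 2 ∂τ : ℝ) * s ^ 2 / 2)) =o[𝓝 0] fun s : ℝ => s ^ 2 := by
    intro τ _ hτ
    have h := taylor_isLittleO_univ (n := 2) (x₀ := 0)
      (contDiff_charFun (μ := τ) (n := 2) (by exact_mod_cast hτ))
    have h3 : ∀ s, taylorWithinEval (charFun τ) 2 Set.univ 0 s = 1 + (∫ x, x ∂τ : ℝ) * s * Complex.I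
        - (∫ x, x ^ 2 ∂τ : ℝ) * s ^ 2 / 2 := fun s => by
      have := taylorWithinEval_charFun_two_zero (P := τ) (X := id) aemeasurable_id
        (by simpa using hτ) s
      simpa using this
    simp only [h3, sub_zero] at h
    exact h
  have h := (key hν).sub (key hρ)
  rw [h1, h2] at h
  refine h.congr_left fun s => ?_
  ring

lemma charFun_sub_gaussianReal_isLittleO {ν : Measure ℝ} [IsProbabilityMeasure ν]
    (hν : MemLp id 2 ν) :
    (fun s => charFun ν s - charFun (gaussianReal (∫ x, x ∂ν) (variance id ν).toNNReal) s)
      =o[𝓝 0] fun s : ℝ => s ^ 2 := by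
  have hg : MemLp id 2 (gaussianReal (∫ x, x ∂ν) (variance id ν).toNNReal) :=
    memLp_id_gaussianReal 2
  refine charFun_sub_charFun_isLittleO hν hg integral_id_gaussianReal.symm ?_
  have a1 := variance_eq_sub hν
  have a2 := variance_eq_sub hg
  rw [variance_id_gaussianReal, Real.coe_toNNReal _ (variance_nonneg _ _)] at a2
  simp only [Pi.pow_apply, id, integral_id_gaussianReal] at a1 a2
  linarith

/-! ### Random selection and mixtures -/

/-- The characteristic function of a sum of independent variables whose indices are selected by
an independent random element is the mean of the product of the characteristic functions. -/
lemma charFun_sum_randomIndex {Ω κ 𝓜 ι : Type*} [MeasurableSpace Ω] [MeasurableSpace 𝓜]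
    {P : Measure Ω} [IsProbabilityMeasure P] {R : κ → Ω → ℝ} {M : Ω → 𝓜}
    (hR : ∀ k, Measurable (R k)) (hM : Measurable M) (hind : iIndepFun R P)
    (hRM : IndepFun (fun ω k => R k ω) M P) (E : Finset ι) (f : ι → 𝓜 → κ)
    (hf : ∀ y, Function.Injective (f · y))
    (hfm : ∀ i, Measurable fun p : (κ → ℝ) × 𝓜 => p.1 (f i p.2)) (s : ℝ) :
    charFun (P.map fun ω => ∑ i ∈ E, R (f i (M ω)) ω) s =
      ∫ ω, ∏ i ∈ E, charFun (P.map (R (f i (M ω)))) s ∂P := by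
  have hRm : Measurable fun ω k => R k ω := measurable_pi_lambda _ hR
  have hsum : Measurable fun p : (κ → ℝ) × 𝓜 => ∑ i ∈ E, p.1 (f i p.2) :=
    Finset.measurable_sum _ fun i _ => hfm i
  have hexp : Measurable fun p : (κ → ℝ) × 𝓜 =>
      Complex.exp (s * (∑ i ∈ E, p.1 (f i p.2) : ℝ) * Complex.I) := by fun_prop
  have hbd : ∀ p : (κ → ℝ) × 𝓜,
      ‖Complex.exp (s * (∑ i ∈ E, p.1 (f i p.2) : ℝ) * Complex.I)‖ ≤ 1 := fun p => by
    rw [← Complex.ofReal_mul, Complex.norm_exp_ofReal_mul_I]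
  have hin : ∀ y, ∫ x : κ → ℝ, Complex.exp (s * (∑ i ∈ E, x (f i y) : ℝ) * Complex.I)
      ∂(P.map fun ω k => R k ω) = ∏ i ∈ E, charFun (P.map (R (f i y))) s := fun y => by
    have hmy : Measurable fun x : κ → ℝ => ∑ i ∈ E, x (f i y) := by fun_prop
    have hey : Measurable fun x : κ → ℝ =>
        Complex.exp (s * (∑ i ∈ E, x (f i y) : ℝ) * Complex.I) := by fun_prop
    rw [integral_map hRm.aemeasurable hey.aestronglyMeasurable]
    -- Once `y` is fixed, injectivity makes the selected variables a subfamily of the independent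
    -- family.
    have h := (((hind.precomp (hf y)).restrict E)).charFun_map_fun_finsetSum_eq_prod
      (fun i _ => (hR (f i y)).aemeasurable)
    have h' := congrFun h s
    rw [Finset.prod_apply, charFun_apply_real, integral_map
      (Finset.measurable_sum _ fun i _ => hR (f i y)).aemeasurable (by fun_prop)] at h'
    exact h'
  have := Measure.isProbabilityMeasure_map (μ := P) hRm.aemeasurable
  have := Measure.isProbabilityMeasure_map (μ := P) hM.aemeasurable
  have hpair := hRM.map_prod_eq_prod_map_map hRm.aemeasurable hM.aemeasurable
  have hint : Integrable (fun p : (κ → ℝ) × 𝓜 =>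
      Complex.exp (s * (∑ i ∈ E, p.1 (f i p.2) : ℝ) * Complex.I))
      ((P.map fun ω k => R k ω).prod (P.map M)) :=
    .of_bound hexp.aestronglyMeasurable 1 (ae_of_all _ hbd)
  have hsum' : Measurable fun ω => ∑ i ∈ E, R (f i (M ω)) ω := hsum.comp (hRm.prodMk hM)
  rw [charFun_apply_real, integral_map hsum'.aemeasurable (by fun_prop)]
  calc _ = ∫ p : (κ → ℝ) × 𝓜, Complex.exp (s * (∑ i ∈ E, p.1 (f i p.2) : ℝ) * Complex.I)
        ∂(P.map fun ω => ((fun k => R k ω), M ω)) := by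
          rw [integral_map (hRm.prodMk hM).aemeasurable hexp.aestronglyMeasurable]
    _ = ∫ y, ∏ i ∈ E, charFun (P.map (R (f i y))) s ∂(P.map M) := by
          rw [hpair, integral_prod_symm _ hint]
          simp_rw [hin]
    _ = _ := by
          rw [integral_map hM.aemeasurable]
          -- The product is measurable in `y` because it equals the inner integral in Fubini's
          -- theorem.
          refine AEStronglyMeasurable.congr (f := fun y => ∫ x : κ → ℝ, _ ∂_) ?_
            (ae_of_all _ hin)
          exact hint.integral_prod_right.aestronglyMeasurable

/-- Mean and variance of a mixture of two laws. -/
lemma mixture_moments {ΩU ΩV ΩW : Type*} [MeasurableSpace ΩU] [MeasurableSpace ΩV]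
    [MeasurableSpace ΩW] {PU : Measure ΩU} [IsProbabilityMeasure PU]
    {PV : Measure ΩV} [IsProbabilityMeasure PV] {PW : Measure ΩW} [IsProbabilityMeasure PW]
    {U : ΩU → ℝ} {V : ΩV → ℝ} {W : ΩW → ℝ} (hU : MemLp U 2 PU) (hV : MemLp V 2 PV)
    (hW_meas : AEMeasurable W PW) {p : ℝ} (hp0 : 0 ≤ p) (hp1 : p ≤ 1)
    (hW : ∀ C : Set ℝ, MeasurableSet C →
      PW.real (W ⁻¹' C) = (1 - p) * PU.real (U ⁻¹' C) + p * PV.real (V ⁻¹' C)) :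
    ∫ w, W w ∂PW = (1 - p) * ∫ u, U u ∂PU + p * ∫ v, V v ∂PV ∧
    variance W PW = (1 - p) * variance U PU + p * variance V PV +
      p * (1 - p) * ((∫ v, V v ∂PV) - ∫ u, U u ∂PU) ^ 2 := by
  have hUm := hU.aestronglyMeasurable.aemeasurable
  have hVm := hV.aestronglyMeasurable.aemeasurable
  have hmap : PW.map W = ENNReal.ofReal (1 - p) • PU.map U + ENNReal.ofReal p • PV.map V := by
    ext C hC
    have h := hW C hC
    rw [Measure.add_apply, Measure.smul_apply, Measure.smul_apply,
      Measure.map_apply_of_aemeasurable hW_meas hC, Measure.map_apply_of_aemeasurable hUm hC,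
      Measure.map_apply_of_aemeasurable hVm hC, smul_eq_mul, smul_eq_mul,
      ← ofReal_measureReal, ← ofReal_measureReal, ← ofReal_measureReal, h,
      ENNReal.ofReal_add (mul_nonneg (by linarith) measureReal_nonneg)
        (mul_nonneg hp0 measureReal_nonneg), ENNReal.ofReal_mul (by linarith),
      ENNReal.ofReal_mul hp0]
  have hint : ∀ g : ℝ → ℝ, Measurable g → Integrable (fun u => g (U u)) PU →
      Integrable (fun v => g (V v)) PV → Integrable (fun w => g (W w)) PW ∧
      ∫ w, g (W w) ∂PW = (1 - p) * ∫ u, g (U u) ∂PU + p * ∫ v, g (V v) ∂PV := by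
    intro g hg hgU hgV
    have hgU' : Integrable g (PU.map U) :=
      (integrable_map_measure hg.aestronglyMeasurable hUm).2 hgU
    have hgV' : Integrable g (PV.map V) :=
      (integrable_map_measure hg.aestronglyMeasurable hVm).2 hgV
    have hU'' := hgU'.smul_measure (c := ENNReal.ofReal (1 - p)) ENNReal.ofReal_ne_top
    have hV'' := hgV'.smul_measure (c := ENNReal.ofReal p) ENNReal.ofReal_ne_top
    refine ⟨(integrable_map_measure hg.aestronglyMeasurable hW_meas).1
      (hmap ▸ hU''.add_measure hV''), ?_⟩
    rw [← integral_map hW_meas hg.aestronglyMeasurable, hmap, integral_add_measure hU'' hV'',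
      integral_smul_measure, integral_smul_measure, integral_map hUm hg.aestronglyMeasurable,
      integral_map hVm hg.aestronglyMeasurable, ENNReal.toReal_ofReal (by linarith),
      ENNReal.toReal_ofReal hp0, smul_eq_mul, smul_eq_mul]
  have h1 := (hint id measurable_id (hU.integrable (by norm_num)) (hV.integrable (by norm_num))).2
  obtain ⟨i2, h2⟩ := hint (· ^ 2) (by fun_prop) hU.integrable_sq hV.integrable_sq
  have hWL : MemLp W 2 PW := (memLp_two_iff_integrable_sq hW_meas.aestronglyMeasurable).2 i2
  simp only [id] at h1
  refine ⟨h1, ?_⟩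
  rw [variance_eq_sub hWL, variance_eq_sub hU, variance_eq_sub hV]
  simp only [Pi.pow_apply]
  rw [h1, h2]
  ring

/-! ### Conditioning on the colours -/

/-- Compatibility makes the endpoints of `k` the same in every graph containing it, up to order, so
the existential in `D` reduces to one pair. -/
lemma exists_D_eq_ite {α β Ω C : Type*} [DecidableEq C] {G : ℕ → Graph α β}
    (hcompat : ∀ m n, (G m).Compatible (G n)) (M : α → Ω → C) (k : allEdges G) :
    ∃ i j : allVerts G, ∀ ω, D G M k ω = if M i ω = M j ω then 1 else 0 := by
  obtain ⟨k, hk⟩ := k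
  obtain ⟨m₀, hm₀⟩ := Set.mem_iUnion.1 hk
  obtain ⟨x, y, hxy⟩ := ((G m₀).edge_mem_iff_exists_isLink k).1 hm₀
  refine ⟨⟨x, Set.mem_iUnion.2 ⟨m₀, hxy.left_mem⟩⟩, ⟨y, Set.mem_iUnion.2 ⟨m₀, hxy.right_mem⟩⟩,
    fun ω => ?_⟩
  have h : (∃ m i j, (G m).IsLink k i j ∧ M i ω = M j ω) ↔ M x ω = M y ω := by
    constructor
    · rintro ⟨m, i, j, hij, h⟩
      obtain ⟨rfl, rfl⟩ | ⟨rfl, rfl⟩ :=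
        (hij.of_compatible (hcompat m m₀) hm₀).eq_and_eq_or_eq_and_eq hxy
      · exact h
      · exact h.symm
    · exact fun h => ⟨m₀, x, y, hxy, h⟩
  simp only [D, h]

/-- Slutsky: convergence in law of `ξ` together with a deterministic limit of `c` gives joint
convergence in law. -/
lemma tendsto_integral_of_tendstoInDistribution {Ω Ω' : Type*} [MeasurableSpace Ω]
    [MeasurableSpace Ω'] {P : Measure Ω} [IsProbabilityMeasure P] {P' : Measure Ω'}
    [IsProbabilityMeasure P'] {ξ : ℕ → Ω → ℝ} {Y : Ω' → ℝ}
    (hY : TendstoInDistribution ξ atTop Y (fun _ => P) P') {c : ℕ → ℝ} {c₀ : ℝ}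
    (hc : Tendsto c atTop (𝓝 c₀)) {F : ℝ × ℝ → ℂ} (hF : Continuous F) {B : ℝ}
    (hB : ∀ x, ‖F x‖ ≤ B) :
    Tendsto (fun m => ∫ ω, F (ξ m ω, c m) ∂P) atTop (𝓝 (∫ ω, F (Y ω, c₀) ∂P')) := by
  have hcm : TendstoInMeasure P (fun m (_ : Ω) => c m) atTop (fun _ => c₀) :=
    tendstoInMeasure_of_tendsto_ae (fun _ => aestronglyMeasurable_const) (ae_of_all _ fun _ => hc)
  have h := hY.prodMk_of_tendstoInMeasure_const ξ (fun m _ => c m) Y hcm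
    (fun _ => aemeasurable_const)
  have h' := (ProbabilityMeasure.tendsto_iff_forall_integral_rclike_tendsto ℂ).1 h.tendsto
    (BoundedContinuousFunction.ofNormedAddCommGroup F hF B hB)
  simp only [ProbabilityMeasure.coe_mk, BoundedContinuousFunction.coe_ofNormedAddCommGroup] at h'
  rw [integral_map h.aemeasurable_limit hF.aestronglyMeasurable] at h'
  refine h'.congr fun m => ?_
  rw [integral_map (h.forall_aemeasurable m) hF.aestronglyMeasurable]

/-- The characteristic function of the sum of the `X_k`, obtained by conditioning on the
colours. -/
lemma charFun_sum_X {α β Ω C : Type*} [MeasurableSpace Ω] [MeasurableSpace C]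
    [MeasurableSingletonClass C] [Countable C] {P : Measure Ω} [IsProbabilityMeasure P]
    {G : ℕ → Graph α β} (hcompat : ∀ m n, (G m).Compatible (G n)) {M : α → Ω → C}
    (hM_meas : ∀ i ∈ allVerts G, Measurable (M i)) {Uk Vk : β → Ω → ℝ}
    (hUk_meas : ∀ k ∈ allEdges G, Measurable (Uk k))
    (hVk_meas : ∀ k ∈ allEdges G, Measurable (Vk k)) {νU νV : Measure ℝ}
    (hUk : ∀ k ∈ allEdges G, P.map (Uk k) = νU) (hVk : ∀ k ∈ allEdges G, P.map (Vk k) = νV)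
    (hUV_indep : iIndepFun
      (Sum.elim (fun k : allEdges G => Uk k) (fun k : allEdges G => Vk k)) P)
    (hUVM_indep : IndepFun
      (fun ω (s : allEdges G ⊕ allEdges G) =>
        Sum.elim (fun k : allEdges G => Uk k) (fun k : allEdges G => Vk k) s ω)
      (fun ω (i : allVerts G) => M i ω) P)
    {E : Finset β} (hE : ∀ k ∈ E, k ∈ allEdges G) (s : ℝ) :
    charFun (P.map fun ω => ∑ k ∈ E, X G M Uk Vk k ω) s =
      ∫ ω, charFun νU s ^ (∑ k ∈ E, (1 - D G M k ω)) * charFun νV s ^ (∑ k ∈ E, D G M k ω) ∂P := by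
  classical
  choose i j hij using exists_D_eq_ite hcompat M
  let ι (k : E) : allEdges G := ⟨k, hE k k.2⟩
  have hι : Function.Injective ι := fun a b hab => by simpa [ι] using hab
  let f (k : E) (y : allVerts G → C) : allEdges G ⊕ allEdges G :=
    if y (i (ι k)) = y (j (ι k)) then .inr (ι k) else .inl (ι k)
  have hset (k : E) : MeasurableSet {p : (allEdges G ⊕ allEdges G → ℝ) × (allVerts G → C) |
      p.2 (i (ι k)) = p.2 (j (ι k))} :=
    measurableSet_eq_fun (by fun_prop) (by fun_prop)
  have key := charFun_sum_randomIndex (P := P)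
    (R := Sum.elim (fun k : allEdges G => Uk k) (fun k : allEdges G => Vk k))
    (M := fun ω (i : allVerts G) => M i ω)
    (by rintro (k | k); exacts [hUk_meas k k.2, hVk_meas k k.2])
    (measurable_pi_lambda _ fun i => hM_meas i i.2) hUV_indep hUVM_indep E.attach f
    (fun y a b hab => by
      apply hι
      by_cases ha : y (i (ι a)) = y (j (ι a)) <;> by_cases hb : y (i (ι b)) = y (j (ι b)) <;>
        simp only [f, ha, hb, if_true, if_false, reduceCtorEq, Sum.inl.injEq, Sum.inr.injEq]
          at hab <;>
        exact hab)
    (fun k => by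
      have : (fun p : (allEdges G ⊕ allEdges G → ℝ) × (allVerts G → C) => p.1 (f k p.2)) =
          fun p => if p.2 (i (ι k)) = p.2 (j (ι k)) then p.1 (.inr (ι k)) else p.1 (.inl (ι k)) := by
        funext p
        simp only [f]
        split_ifs <;> rfl
      rw [this]
      exact Measurable.ite (hset k) (by fun_prop) (by fun_prop)) s
  have hX : (fun ω => ∑ k ∈ E, X G M Uk Vk k ω) = fun ω => ∑ k ∈ E.attach,
      Sum.elim (fun k : allEdges G => Uk k) (fun k : allEdges G => Vk k)
        (f k fun i => M i ω) ω := by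
    funext ω
    rw [← Finset.sum_attach]
    refine Finset.sum_congr rfl fun k _ => ?_
    have h := hij (ι k) ω
    simp only [X, f]
    change D G M k ω = _ at h
    rw [h]
    split_ifs <;> simp_all [ι]
  rw [hX, key]
  congr 1
  funext ω
  rw [← Finset.sum_attach, ← Finset.sum_attach (f := fun k => D G M k ω),
    ← Finset.prod_pow_eq_pow_sum, ← Finset.prod_pow_eq_pow_sum, ← Finset.prod_mul_distrib]
  refine Finset.prod_congr rfl fun k _ => ?_
  have h := hij (ι k) ω
  change D G M k ω = _ at h
  rw [h]
  simp only [f]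
  split_ifs with hM
  · simp [hVk _ (ι k).2]
  · simp [hUk _ (ι k).2]

/-! ### The Gaussian case -/

/-- The conditional characteristic function at `t` of the standardized sum given the colours, as
a function of the standardized count and the inverse square root of the number of edges, for
Gaussian summands with variances `vU` and `vV`. -/
noncomputable def phase (p r σ vU vV t : ℝ) (x : ℝ × ℝ) : ℂ :=
  Complex.exp ((t * r * x.1 : ℝ) * Complex.I - (t ^ 2 / (2 * σ ^ 2) *
    ((1 - max 0 (min 1 (p + √(p * (1 - p)) * x.1 * x.2))) * vU +
      max 0 (min 1 (p + √(p * (1 - p)) * x.1 * x.2)) * vV) : ℝ))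

lemma continuous_phase (p r σ vU vV t : ℝ) : Continuous (phase p r σ vU vV t) := by
  unfold phase
  fun_prop

/-- Clamping the weight to `[0, 1]` keeps the variance nonnegative at every real point, not only at
values attained by the counts. -/
lemma norm_phase_le_one (p r σ : ℝ) {vU vV : ℝ} (hU : 0 ≤ vU) (hV : 0 ≤ vV) (t : ℝ) (x : ℝ × ℝ) :
    ‖phase p r σ vU vV t x‖ ≤ 1 := by
  set q := max 0 (min 1 (p + √(p * (1 - p)) * x.1 * x.2)) with hq
  have h0 : 0 ≤ q := le_max_left _ _
  have h1 : 0 ≤ 1 - q := sub_nonneg.2 (max_le zero_le_one (min_le_left _ _))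
  have h2 : 0 ≤ t ^ 2 / (2 * σ ^ 2) * ((1 - q) * vU + q * vV) := by positivity
  rw [phase, Complex.norm_exp, Real.exp_le_one_iff, ← hq,
    Complex.sub_re, Complex.re_ofReal_mul, Complex.I_re, Complex.ofReal_re]
  linarith

/-- The clamp is inactive because the weight is `B / n`, and the means combine through `A a + B b -
n ((1-p) a + p b) = (B - n p)(b - a)`. -/
lemma phase_eq_gaussian_pow {p a b σ vU vV t : ℝ} (hp0 : 0 < p) (hp1 : p < 1) (hσ : 0 < σ)
    {A B n : ℕ} (hAB : A + B = n) (hn : 0 < n) :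
    phase p (√(p * (1 - p)) * (b - a) / σ) σ vU vV t
        (((B : ℝ) - n * p) / √(n * p * (1 - p)), (√n)⁻¹) =
      Complex.exp (-(t / (σ * √n) * (n * ((1 - p) * a + p * b)) : ℝ) * Complex.I) *
      (Complex.exp ((t / (σ * √n) : ℝ) * a * Complex.I - vU * (t / (σ * √n) : ℝ) ^ 2 / 2) ^ A *
      Complex.exp ((t / (σ * √n) : ℝ) * b * Complex.I - vV * (t / (σ * √n) : ℝ) ^ 2 / 2) ^ B) := by
  have hn' : (0 : ℝ) < n := by exact_mod_cast hn
  have hABr : (A : ℝ) = n - B := by rw [← hAB]; push_cast; ring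
  have hBn : (B : ℝ) ≤ n := by exact_mod_cast (by omega : B ≤ n)
  have hpp : 0 < p * (1 - p) := mul_pos hp0 (by linarith)
  have hw : 0 < √(p * (1 - p)) := Real.sqrt_pos.2 hpp
  have hz : 0 < √(n : ℝ) := Real.sqrt_pos.2 hn'
  have hzz : √(n : ℝ) ^ 2 = n := Real.sq_sqrt hn'.le
  have hroot : √(n * p * (1 - p)) = √n * √(p * (1 - p)) := by
    rw [mul_assoc, Real.sqrt_mul hn'.le]
  have hq : p + √(p * (1 - p)) * (((B : ℝ) - n * p) / √(n * p * (1 - p))) * (√n)⁻¹ = B / n := by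
    rw [hroot]
    have : √(p * (1 - p)) * (((B : ℝ) - n * p) / (√n * √(p * (1 - p)))) * (√n)⁻¹ =
        (B - n * p) / √n ^ 2 := by
      field_simp
    rw [this, hzz]
    field_simp
    ring
  have hqmax : max 0 (min 1 ((B : ℝ) / n)) = B / n := by
    rw [min_eq_right ((div_le_one hn').2 hBn), max_eq_right (by positivity)]
  have hx : t * (√(p * (1 - p)) * (b - a) / σ) * (((B : ℝ) - n * p) / √(n * p * (1 - p))) =
      t / (σ * √n) * ((B - n * p) * (b - a)) := by
    rw [hroot]
    field_simp
  have hs : (t / (σ * √n)) ^ 2 = t ^ 2 / (σ ^ 2 * n) := by rw [div_pow, mul_pow, hzz]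
  have hv : t ^ 2 / (2 * σ ^ 2) * ((1 - (B : ℝ) / n) * vU + B / n * vV) =
      (t / (σ * √n)) ^ 2 / 2 * ((n - B) * vU + B * vV) := by
    rw [hs]
    field_simp
  rw [phase, hq, hqmax, hx, hv, ← Complex.exp_nat_mul, ← Complex.exp_nat_mul, ← Complex.exp_add,
    ← Complex.exp_add]
  congr 1
  have hAc : (A : ℂ) = n - B := by exact_mod_cast congrArg (fun x : ℝ => (x : ℂ)) hABr
  rw [hAc]
  push_cast
  ring

lemma charFun_map_sub_div {Ω : Type*} [MeasurableSpace Ω] {P : Measure Ω} {T : Ω → ℝ}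
    (hT : AEMeasurable T P) (c d t : ℝ) :
    charFun (P.map fun ω => (T ω - c) / d) t =
      Complex.exp (-(t / d * c : ℝ) * Complex.I) * charFun (P.map T) (t / d) := by
  rw [charFun_apply_real, charFun_apply_real, integral_map (by fun_prop) (by fun_prop),
    integral_map hT (by fun_prop), ← integral_const_mul]
  congr 1
  funext ω
  rw [← Complex.exp_add]
  congr 1
  push_cast
  ring

/-- The scaling keeps `n * (t / (σ√n)) ^ 2` bounded by `(t / σ) ^ 2`. -/
lemma tendsto_mul_norm_of_isLittleO_sq {f : ℝ → ℂ} (hf : f =o[𝓝 0] fun s : ℝ => s ^ 2)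
    {n : ℕ → ℕ} (hn : Tendsto n atTop atTop) (t σ : ℝ) :
    Tendsto (fun m => (n m : ℝ) * ‖f (t / (σ * √(n m)))‖) atTop (𝓝 0) := by
  have hs : Tendsto (fun m => t / (σ * √(n m))) atTop (𝓝 0) := by
    have h : Tendsto (fun m => (√(n m : ℝ))⁻¹) atTop (𝓝 0) :=
      tendsto_inv_atTop_zero.comp (Real.tendsto_sqrt_atTop.comp
        (tendsto_natCast_atTop_atTop.comp hn))
    have h' := h.const_mul (t / σ)
    rw [mul_zero] at h'
    refine h'.congr fun m => ?_
    rw [← div_eq_mul_inv, div_div]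
  have ho := (hf.comp_tendsto hs).norm_left
  have h1 : (fun m => (n m : ℝ) * ‖f (t / (σ * √(n m)))‖) =o[atTop]
      fun m => (n m : ℝ) * (t / (σ * √(n m))) ^ 2 :=
    (Asymptotics.isBigO_refl _ _).mul_isLittleO ho
  have h2 : (fun m => (n m : ℝ) * (t / (σ * √(n m))) ^ 2) =O[atTop] fun _ => (1 : ℝ) := by
    refine Asymptotics.IsBigO.of_bound ((t / σ) ^ 2) (Eventually.of_forall fun m => ?_)
    rcases Nat.eq_zero_or_pos (n m) with h | h
    · simp [h]; positivity
    · have : (0 : ℝ) < n m := by exact_mod_cast h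
      rw [div_pow, mul_pow, Real.sq_sqrt this.le, div_pow, norm_one, mul_one,
        Real.norm_of_nonneg (by positivity)]
      refine le_of_eq ?_
      rcases eq_or_ne σ 0 with rfl | hσ
      · simp
      · field_simp
  exact (Asymptotics.isLittleO_one_iff ℝ).1 (h1.trans_isBigO h2)

end MonoEdges

/-! ### Convergence of the standardized sums -/

theorem theorem2
    {α β Ω ΩU ΩV ΩW Ω' : Type*}
    [MeasurableSpace Ω] [MeasurableSpace ΩU] [MeasurableSpace ΩV] [MeasurableSpace ΩW]
    [MeasurableSpace Ω']
    (P : Measure Ω) [IsProbabilityMeasure P]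
    (PU : Measure ΩU) [IsProbabilityMeasure PU]
    (PV : Measure ΩV) [IsProbabilityMeasure PV]
    (PW : Measure ΩW) [IsProbabilityMeasure PW]
    (P' : Measure Ω') [IsProbabilityMeasure P']
    (G : ℕ → Graph α β)
    (hfin : ∀ m, (G m).edgeSet.Finite)
    (hcompat : ∀ m n, (G m).Compatible (G n))
    (hn : Tendsto (fun m => (hfin m).toFinset.card) atTop atTop)
    -- independent uniform colours of the vertices
    (ℓ : ℕ) (hℓ : 2 ≤ ℓ)
    (M : α → Ω → Fin ℓ)
    (hM_meas : ∀ i ∈ MonoEdges.allVerts G, Measurable (M i))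
    (hM_unif : ∀ i ∈ MonoEdges.allVerts G, ∀ c : Fin ℓ, P.real (M i ⁻¹' {c}) = (ℓ : ℝ)⁻¹)
    (hM_indep : iIndepFun (fun i : MonoEdges.allVerts G => M i) P)
    -- the generic random variables, `W` being a mixture of `U` and `V`
    (U : ΩU → ℝ) (V : ΩV → ℝ) (W : ΩW → ℝ)
    (hU : MemLp U 2 PU) (hV : MemLp V 2 PV) (hW_meas : AEMeasurable W PW)
    (hW : ∀ C : Set ℝ, MeasurableSet C →
      PW.real (W ⁻¹' C) =
        (1 - (ℓ : ℝ)⁻¹) * PU.real (U ⁻¹' C) + (ℓ : ℝ)⁻¹ * PV.real (V ⁻¹' C))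
    -- independent copies of `U` and `V` on the edges, independent of the colours
    (Uk Vk : β → Ω → ℝ)
    (hUk_meas : ∀ k ∈ MonoEdges.allEdges G, Measurable (Uk k))
    (hVk_meas : ∀ k ∈ MonoEdges.allEdges G, Measurable (Vk k))
    (hUk : ∀ k ∈ MonoEdges.allEdges G, IdentDistrib (Uk k) U P PU)
    (hVk : ∀ k ∈ MonoEdges.allEdges G, IdentDistrib (Vk k) V P PV)
    (hUV_indep : iIndepFun
      (Sum.elim (fun k : MonoEdges.allEdges G => Uk k) (fun k : MonoEdges.allEdges G => Vk k)) P)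
    (hUVM_indep : IndepFun
      (fun ω (s : MonoEdges.allEdges G ⊕ MonoEdges.allEdges G) =>
        Sum.elim (fun k : MonoEdges.allEdges G => Uk k)
          (fun k : MonoEdges.allEdges G => Vk k) s ω)
      (fun ω (i : MonoEdges.allVerts G) => M i ω) P)
    -- mean and standard deviation of `W`, and the coefficient `r`
    (μ σ r : ℝ) (hμ : μ = ∫ w, W w ∂PW) (hσ : 0 < σ) (hσW : σ ^ 2 = variance W PW)
    (hr : r = √((ℓ : ℝ)⁻¹ * (1 - (ℓ : ℝ)⁻¹)) * ((∫ v, V v ∂PV) - ∫ u, U u ∂PU) / σ)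
    -- the limit `Y` of the standardized counts, and an independent standard normal `Z`
    (Y Z : Ω' → ℝ)
    (hZ : HasLaw Z (gaussianReal 0 1) P') (hYZ : IndepFun Z Y P')
    (hY : TendstoInDistribution (fun m => MonoEdges.xi ℓ G M (hfin m).toFinset) atTop Y
      (fun _ => P) P') :
    r ^ 2 ≤ 1 ∧
      TendstoInDistribution (fun m => MonoEdges.S G M Uk Vk μ σ (hfin m).toFinset) atTop
        (fun ω => √(1 - r ^ 2) * Z ω + r * Y ω) (fun _ => P) P' := by
  have hℓ0 : (2 : ℝ) ≤ ℓ := by exact_mod_cast hℓ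
  set p : ℝ := (ℓ : ℝ)⁻¹ with hp
  have hp0 : 0 < p := by positivity
  have hp1 : p < 1 := inv_lt_one_of_one_lt₀ (by linarith)
  set a := ∫ u, U u ∂PU with ha
  set b := ∫ v, V v ∂PV with hb
  obtain ⟨hmean, hvar⟩ := MonoEdges.mixture_moments hU hV hW_meas hp0.le hp1.le hW
  rw [← ha, ← hb, ← hμ] at hmean
  rw [← ha, ← hb, ← hσW] at hvar
  have hUm := hU.aestronglyMeasurable.aemeasurable
  have hVm := hV.aestronglyMeasurable.aemeasurable
  have := Measure.isProbabilityMeasure_map hUm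
  have := Measure.isProbabilityMeasure_map hVm
  have hidU : MemLp id 2 (PU.map U) := (memLp_map_measure_iff (by fun_prop) hUm).2 hU
  have hidV : MemLp id 2 (PV.map V) := (memLp_map_measure_iff (by fun_prop) hVm).2 hV
  have oU := MonoEdges.charFun_sub_gaussianReal_isLittleO hidU
  have oV := MonoEdges.charFun_sub_gaussianReal_isLittleO hidV
  rw [integral_map hUm (by fun_prop), variance_map (by fun_prop) hUm, ← ha, Function.id_comp] at oU
  rw [integral_map hVm (by fun_prop), variance_map (by fun_prop) hVm, ← hb, Function.id_comp] at oV
  set vU := variance U PU with hvU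
  set vV := variance V PV with hvV
  have hvU0 : 0 ≤ vU := variance_nonneg _ _
  have hvV0 : 0 ≤ vV := variance_nonneg _ _
  have hpp : 0 ≤ p * (1 - p) := mul_nonneg hp0.le (by linarith)
  have hr2 : σ ^ 2 * r ^ 2 = p * (1 - p) * (b - a) ^ 2 := by
    rw [hr, div_pow, mul_pow, Real.sq_sqrt hpp]
    field_simp
  have hvarr : (1 - p) * vU + p * vV = σ ^ 2 * (1 - r ^ 2) := by linarith
  have hr1 : r ^ 2 ≤ 1 := by
    have h : 0 ≤ (1 - p) * vU + p * vV :=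
      add_nonneg (mul_nonneg (by linarith) hvU0) (mul_nonneg hp0.le hvV0)
    rw [hvarr] at h
    have := nonneg_of_mul_nonneg_right h (by positivity)
    linarith
  refine ⟨hr1, ?_⟩
  have hEmem : ∀ m, ∀ k ∈ (hfin m).toFinset, k ∈ MonoEdges.allEdges G := fun m k hk =>
    Set.mem_iUnion.2 ⟨m, (hfin m).mem_toFinset.1 hk⟩
  have hDmeas : ∀ k ∈ MonoEdges.allEdges G, Measurable (MonoEdges.D G M k) := by
    intro k hk
    obtain ⟨i, j, hij⟩ := MonoEdges.exists_D_eq_ite hcompat M ⟨k, hk⟩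
    rw [show MonoEdges.D G M k = _ from funext hij]
    exact Measurable.ite (measurableSet_eq_fun (hM_meas i i.2) (hM_meas j j.2))
      measurable_const measurable_const
  have hXmeas : ∀ k ∈ MonoEdges.allEdges G, Measurable (MonoEdges.X G M Uk Vk k) := fun k hk =>
    Measurable.ite (hDmeas k hk (measurableSet_singleton 0)) (hUk_meas k hk) (hVk_meas k hk)
  have hsum_meas : ∀ m, Measurable fun ω => ∑ k ∈ (hfin m).toFinset, MonoEdges.X G M Uk Vk k ω :=
    fun m => Finset.measurable_fun_sum _ fun k hk => hXmeas k (hEmem m k hk)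
  have hcount : ∀ m ω, (∑ k ∈ (hfin m).toFinset, (1 - MonoEdges.D G M k ω)) +
      ∑ k ∈ (hfin m).toFinset, MonoEdges.D G M k ω = (hfin m).toFinset.card := fun m ω => by
    rw [← Finset.sum_add_distrib, Finset.card_eq_sum_ones]
    refine Finset.sum_congr rfl fun k _ => Nat.sub_add_cancel ?_
    unfold MonoEdges.D
    split_ifs <;> simp
  have hYm := hY.aemeasurable_limit
  have hZm := hZ.aemeasurable
  refine ⟨fun m => (((hsum_meas m).sub_const _).div_const _).aemeasurable, by fun_prop, ?_⟩
  refine ProbabilityMeasure.tendsto_iff_tendsto_charFun.2 fun t => ?_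
  simp only [ProbabilityMeasure.coe_mk]
  set N : ℕ → ℕ := fun m => (hfin m).toFinset.card with hN
  set F := MonoEdges.phase p r σ vU vV t with hF
  have hFc : Continuous F := MonoEdges.continuous_phase _ _ _ _ _ _
  have hFb : ∀ x, ‖F x‖ ≤ 1 := MonoEdges.norm_phase_le_one p r σ hvU0 hvV0 t
  have hroot : Tendsto (fun m => (√(N m : ℝ))⁻¹) atTop (𝓝 0) :=
    tendsto_inv_atTop_zero.comp (Real.tendsto_sqrt_atTop.comp
      (tendsto_natCast_atTop_atTop.comp hn))
  have hlim := MonoEdges.tendsto_integral_of_tendstoInDistribution hY hroot hFc hFb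
  -- At second coordinate `0` the weight is `p`, so the Gaussian factor no longer depends on `Y` and
  -- the integral factorizes.
  have hlimit : ∫ ω, F (Y ω, 0) ∂P' =
      charFun (P'.map fun ω => √(1 - r ^ 2) * Z ω + r * Y ω) t := by
    have hind : IndepFun (fun ω => √(1 - r ^ 2) * Z ω) (fun ω => r * Y ω) P' :=
      hYZ.comp (φ := fun x => √(1 - r ^ 2) * x) (ψ := fun x => r * x) (by fun_prop) (by fun_prop)
    rw [hind.charFun_map_fun_add_eq_mul (by fun_prop) (by fun_prop), Pi.mul_apply,
      charFun_map_mul_comp hZm, charFun_map_mul_comp hYm, hZ.map_eq, charFun_gaussianReal,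
      charFun_apply_real, integral_map hYm (by fun_prop), ← integral_const_mul]
    congr 1
    funext ω
    have h1 : t ^ 2 / (2 * σ ^ 2) * ((1 - p) * vU + p * vV) = (√(1 - r ^ 2) * t) ^ 2 / 2 := by
      rw [hvarr, mul_pow, Real.sq_sqrt (by linarith)]
      field_simp
    simp only [hF, MonoEdges.phase, mul_zero, add_zero, min_eq_right hp1.le, max_eq_right hp0.le]
    rw [h1, ← Complex.exp_add]
    congr 1
    push_cast
    ring
  rw [hlimit] at hlim
  have herr : Tendsto (fun m => (N m : ℝ) *
      (‖charFun (PU.map U) (t / (σ * √(N m))) -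
          charFun (gaussianReal a vU.toNNReal) (t / (σ * √(N m)))‖ +
        ‖charFun (PV.map V) (t / (σ * √(N m))) -
          charFun (gaussianReal b vV.toNNReal) (t / (σ * √(N m)))‖)) atTop (𝓝 0) := by
    simpa only [mul_add, add_zero] using
      (MonoEdges.tendsto_mul_norm_of_isLittleO_sq oU hn t σ).add
        (MonoEdges.tendsto_mul_norm_of_isLittleO_sq oV hn t σ)
  refine hlim.congr_dist (squeeze_zero' (Eventually.of_forall fun _ => dist_nonneg) ?_ herr)
  filter_upwards [hn.eventually_gt_atTop 0] with m hm
  set E := (hfin m).toFinset with hE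
  set s := t / (σ * √(N m)) with hs
  have hS : charFun (P.map (MonoEdges.S G M Uk Vk μ σ E)) t =
      ∫ ω, Complex.exp (-(s * (N m * μ) : ℝ) * Complex.I) *
        (charFun (PU.map U) s ^ (∑ k ∈ E, (1 - MonoEdges.D G M k ω)) *
          charFun (PV.map V) s ^ (∑ k ∈ E, MonoEdges.D G M k ω)) ∂P := by
    have h := MonoEdges.charFun_map_sub_div (P := P) (hsum_meas m).aemeasurable
      (N m * μ) (σ * √(N m)) t
    rw [MonoEdges.charFun_sum_X hcompat hM_meas hUk_meas hVk_meas
      (fun k hk => (hUk k hk).map_eq) (fun k hk => (hVk k hk).map_eq) hUV_indep hUVM_indep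
      (hEmem m), ← integral_const_mul] at h
    exact h
  have hpow : ∀ ω, F (MonoEdges.xi ℓ G M E ω, (√(N m : ℝ))⁻¹) =
      Complex.exp (-(s * (N m * μ) : ℝ) * Complex.I) *
        (charFun (gaussianReal a vU.toNNReal) s ^ (∑ k ∈ E, (1 - MonoEdges.D G M k ω)) *
          charFun (gaussianReal b vV.toNNReal) s ^ (∑ k ∈ E, MonoEdges.D G M k ω)) := fun ω => by
    have h := MonoEdges.phase_eq_gaussian_pow (p := p) (a := a) (b := b) (σ := σ) (vU := vU)
      (vV := vV) (t := t) hp0 hp1 hσ (hcount m ω) hm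
    rw [← hr, ← hmean] at h
    rw [charFun_gaussianReal, charFun_gaussianReal, Real.coe_toNNReal _ hvU0,
      Real.coe_toNNReal _ hvV0, ← h, MonoEdges.xi]
    push_cast
    rfl
  have hA : Measurable fun ω => ∑ k ∈ E, (1 - MonoEdges.D G M k ω) :=
    Finset.measurable_fun_sum _ fun k hk => (measurable_of_countable (1 - ·)).comp
      (hDmeas k (hEmem m k hk))
  have hB : Measurable fun ω => ∑ k ∈ E, MonoEdges.D G M k ω :=
    Finset.measurable_fun_sum _ fun k hk => hDmeas k (hEmem m k hk)
  have hmeas : ∀ z w c : ℂ, Measurable fun ω => c * (z ^ (∑ k ∈ E, (1 - MonoEdges.D G M k ω)) *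
      w ^ (∑ k ∈ E, MonoEdges.D G M k ω)) := fun z w c =>
    (((measurable_of_countable (z ^ ·)).comp hA).mul
      ((measurable_of_countable (w ^ ·)).comp hB)).const_mul c
  have hintegrable : ∀ z w c : ℂ, ‖z‖ ≤ 1 → ‖w‖ ≤ 1 → Integrable (fun ω =>
      c * (z ^ (∑ k ∈ E, (1 - MonoEdges.D G M k ω)) *
        w ^ (∑ k ∈ E, MonoEdges.D G M k ω))) P := fun z w c hz hw => by
    refine .of_bound (hmeas z w c).aestronglyMeasurable ‖c‖ (ae_of_all _ fun ω => ?_)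
    rw [norm_mul, norm_mul, norm_pow, norm_pow]
    exact mul_le_of_le_one_right (norm_nonneg _) (mul_le_one₀ (pow_le_one₀ (norm_nonneg _) hz)
      (by positivity) (pow_le_one₀ (norm_nonneg _) hw))
  rw [dist_comm, dist_eq_norm, hS]
  simp only [hpow]
  rw [← integral_sub (hintegrable _ _ _ (norm_charFun_le_one _) (norm_charFun_le_one _))
    (hintegrable _ _ _ (norm_charFun_le_one _) (norm_charFun_le_one _))]
  refine (norm_integral_le_of_norm_le_const (ae_of_all _ fun ω => ?_)).trans
    (by rw [probReal_univ, mul_one])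
  -- The common centring factor has modulus one.
  rw [← mul_sub, norm_mul, ← Complex.ofReal_neg, Complex.norm_exp_ofReal_mul_I, one_mul]
  exact MonoEdges.norm_pow_mul_pow_sub_le (norm_charFun_le_one _) (norm_charFun_le_one _)
    (norm_charFun_le_one _) (norm_charFun_le_one _) (hcount m ω)
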